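/- Let $P$ be the law of $(X,Y)\in\mathcal X\times\{0,1\}$, with $\pi_+=P(Y=1)>0$, class-conditional law $P_+=P(X\mid Y=1)$ and input marginal $P_X$. Let $f:\mathcal X\to[0,1]$ be a fixed measurable predictor, $\mathcal C$ a class of measurable functions $c:\mathcal X\to[0,1]$, and $\mathcal W$ a class of measurable functions $w:[0,1]\to\mathbb R$ with $\|w\|_\infty\le 1$. Put $$\operatorname{MC}_{\mathcal C,\mathcal W}(f)=\sup_{c\in\mathcal C,\,w\in\mathcal W}\bigl|\mathbb E[c(X)\,w(f(X))\,(Y-f(X))]\bigr| .$$ Let $X^+_1,\dots,X^+_{n_+}$ be i.i.d. from $P_+$ and $X^u_1,\dots,X^u_{n_u}$ i.i.d. from $P_X$, with $n_+,n_u\ge 1$ and $f$ not depending on these samples, and put $$\widehat{\operatorname{MC}}^{\mathrm{PU}}_{\mathcal C,\mathcal W}(f)=\sup_{c\in\mathcal C,\,w\in\mathcal W}\Bigl|\frac{\pi_+}{n_+}\sum_{i=1}^{n_+}c(X_i^+)\,w(f(X_i^+))-\frac1{n_u}\sum_{j=1}^{n_u}c(X_j^u)\,w(f(X_j^u))\,f(X_j^u)\Bigr|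 .$$ For a law $Q$ on $\mathcal X$ let $$\mathfrak R_n(\mathcal C;Q)=\mathbb E_{S\sim Q^n,\,\sigma}\Bigl[\sup_{c\in\mathcal C}\frac1n\sum_{i=1}^n\sigma_i c(X_i)\Bigr]$$ be the expected Rademacher complexity, where $\sigma_1,\dots,\sigma_n\in\{-1,+1\}$ are independent and uniform, and let $N_\infty(\eta,\mathcal W)$ be the least cardinality of an $\eta$-net of $\mathcal W$, contained in $\mathcal W$, in the sup norm. Write $(P_1,n_1,\pi_1)=(P_+,n_+,\pi_+)$ and $(P_2,n_2,\pi_2)=(P_X,n_u,1)$, and assume that the suprema in the definition of $\mathfrak R_{n_s}(\mathcal C;P_s)$, $s=1,2$, are measurable (up to null sets) for every sign vector. Let $\eta\in(0,1]$ with $N_\infty(\eta,\mathcal W)<\infty$ (otherwise the bound is infinite) and $\delta\in(0,1)$. Then, with probability at least $1-\delta$, $$\bigl|\widehat{\operatorname{MC}}^{\mathrm{PU}}_{\mathcal C,\mathcal W}(f)-\operatorname{MC}_{\mathcal C,\mathcal W}(f)\bigr|\le 2\sum_{s=1}^2\pi_s\Bigl(\mathfrak R_{n_s}(\mathcal C;P_s)+\eta+\sqrt{\frac{2\log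 N_\infty(\eta,\mathcal W)+\log(4/\delta)}{n_s}}\Bigr).$$ -/

import Mathlib

open MeasureTheory ProbabilityTheory

namespace PUMulticalibration

noncomputable section

/-- The label `y ∈ {0, 1}` as a real number (`true` is the positive label `1`). -/
def labelValue (y : Bool) : ℝ := if y then 1 else 0

/-- The class prior `π₊ = P(Y = 1)` of a joint law `P` of `(X, Y)`. -/
def prior {X : Type*} [MeasurableSpace X] (P : Measure (X × Bool)) : ℝ :=
  P.real {p | p.2 = true}

/-- The class-conditional law `P₊ = P(X | Y = 1)`. -/
def posLaw {X : Type*} [MeasurableSpace X] (P : Measure (X × Bool)) : Measure X :=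
  (ProbabilityTheory.cond P {p | p.2 = true}).map Prod.fst

/-- The marginal law `P_X` of the input. -/
def inputLaw {X : Type*} [MeasurableSpace X] (P : Measure (X × Bool)) : Measure X :=
  P.map Prod.fst

/-- The multicalibration error
`MC_{C,W}(f) = sup_{c ∈ C, w ∈ W} |E[c(X) w(f(X)) (Y - f(X))]|`. -/
def multicalibrationError {X : Type*} [MeasurableSpace X] (P : Measure (X × Bool))
    (C : Set (X → ℝ)) (W : Set (unitInterval → ℝ)) (f : X → unitInterval) : ℝ :=
  ⨆ cw : C × W, |∫ p, cw.1.1 p.1 * cw.2.1 (f p.1) * (labelValue p.2 - (f p.1 : ℝ)) ∂P|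

/-- The PU estimate of the moment of the witness `(c, w)` from a positive sample `xp` and an
unlabeled sample `xu`, where `q` is the class prior `π₊`. -/
def puMoment {X : Type*} {m n : ℕ} (q : ℝ) (c : X → ℝ) (w : unitInterval → ℝ)
    (f : X → unitInterval) (xp : Fin m → X) (xu : Fin n → X) : ℝ :=
  q / m * ∑ i, c (xp i) * w (f (xp i))
    - 1 / n * ∑ j, c (xu j) * w (f (xu j)) * (f (xu j) : ℝ)

/-- The PU estimate of the multicalibration error: the supremum of the absolute values of the
estimated moments over all witnesses `(c, w)`. -/
def puEstimate {X : Type*} {m n : ℕ} (q : ℝ) (C : Set (X → ℝ)) (W : Set (unitInterval → ℝ))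
    (f : X → unitInterval) (xp : Fin m → X) (xu : Fin n → X) : ℝ :=
  ⨆ cw : C × W, |puMoment q cw.1.1 cw.2.1 f xp xu|

/-- `sup_{c ∈ C} (1/n) ∑ᵢ σᵢ c(xᵢ)` for a sign vector `σ ∈ {-1, +1}ⁿ` and a sample `x`. -/
def signedSup {X : Type*} {n : ℕ} (C : Set (X → ℝ)) (σ : Fin n → ℤˣ) (x : Fin n → X) : ℝ :=
  ⨆ c : C, 1 / (n : ℝ) * ∑ i, ((σ i : ℤ) : ℝ) * c.1 (x i)

/-- For every sign vector, the supremum in the definition of the Rademacher complexity is a random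
variable on the `n`-fold sample space (up to null sets), so that its expectation makes sense. -/
def RademacherMeasurable {X : Type*} [MeasurableSpace X] (n : ℕ) (C : Set (X → ℝ))
    (P : Measure X) : Prop :=
  ∀ σ : Fin n → ℤˣ, AEMeasurable (signedSup C σ) (Measure.pi fun _ : Fin n => P)

/-- The expected Rademacher complexity of `C` under `P` with sample size `n`: the expectation over
an i.i.d. sample from `P` and over independent uniform signs, that is over a uniformly distributed
sign vector in `{-1, +1}ⁿ`. -/
def rademacherComplexity {X : Type*} [MeasurableSpace X] (n : ℕ) (C : Set (X → ℝ))
    (P : Measure X) : ℝ :=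
  ∫ x, (1 / 2 ^ n : ℝ) * ∑ σ : Fin n → ℤˣ, signedSup C σ x ∂(Measure.pi fun _ : Fin n => P)

/-- The covering number of `W` in the sup norm: the least number of points of an `η`-net of `W`
contained in `W`. The type `unitInterval →ᵤ ℝ` is the type of functions with the sup distance. -/
def supCoveringNumber (η : ℝ) (W : Set (unitInterval → ℝ)) : ℕ∞ :=
  Metric.coveringNumber η.toNNReal (UniformFun.ofFun '' W)

end

end PUMulticalibration

/-! Since π₊ E₊[c w(f)] = E[c w(f) Y], the moment of a witness is π₊ times a positive-law mean minus
an input-law mean, and its PU estimate errs by π₊ times one empirical deviation minus another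
(`puMoment_sub_integral_eq`). A supremum of absolute values is 1-Lipschitz in the moments, so it
suffices to bound each deviation uniformly in `(c, w)` outside an event of mass δ/2. The union bound
needs no independence between the two samples.

For fixed `w` the class is `{h * c}` with `|h| ≤ 1`. Only the suprema `signedSup` over `C` itself
are assumed measurable, so the supremum of the deviations is replaced by a majorant built from
finitely many of them. Reading h(xᵢ) as the mean of a random sign εᵢ makes Σ σᵢ h(xᵢ) c(xᵢ) an
average of the sums Σ σᵢ εᵢ c(xᵢ), hence controlled by `weightedSup`; averaging over σ returns the
Rademacher complexity R of `C`, with no contraction lemma. Symmetrization with a ghost sample turns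
this into `ghostBound`: minus 2, it dominates every deviation and has mean 2R, and its differences
are at most 2/n. McDiarmid's inequality then gives `measureReal_uniform_deviation_le`. Replacing `h`
by `-h` gives the other side, and an η-net of `W` costs a factor N in probability and 2η in
deviation. -/

namespace PUMulticalibration

/-! ### McDiarmid's inequality for almost everywhere measurable functions. -/

section BoundedDifferences

variable {X : Type*} [MeasurableSpace X] (Q : Measure X) [IsProbabilityMeasure Q]

/-- The moment generating function bound behind McDiarmid's inequality, for a bounded and a.e.
measurable function of `n` i.i.d. variables with differences bounded by `c`. -/
theorem integral_exp_le_of_bounded_differences (n : ℕ) (F : (Fin n → X) → ℝ)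
    (hF : AEMeasurable F (Measure.pi fun _ => Q)) {K c : ℝ} (hK : ∀ x, |F x| ≤ K)
    (hd : ∀ x i a, |F (Function.update x i a) - F x| ≤ c) (t : ℝ) :
    ∫ x, Real.exp (t * (F x - ∫ y, F y ∂(Measure.pi fun _ => Q))) ∂(Measure.pi fun _ => Q)
      ≤ Real.exp (n * (c ^ 2 * t ^ 2 / 8)) := by
  induction n with
  | zero =>
    have h : ∀ x : Fin 0 → X, F x = F default := fun x => by rw [Subsingleton.elim x default]
    simp [h]
  | succ n ih =>
    set ν : Measure (Fin n → X) := Measure.pi fun _ => Q with hν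
    have mp := (measurePreserving_piFinSuccAbove (fun _ : Fin (n + 1) => Q) 0).symm
    set e := (MeasurableEquiv.piFinSuccAbove (fun _ : Fin (n + 1) => X) 0).symm with he
    have he_cons : ∀ a r, e (a, r) = Fin.cons a r := fun a r => Fin.insertNth_zero' a r
    set G : X × (Fin n → X) → ℝ := fun p => F (e p) with hG
    have hGm : AEMeasurable G (Q.prod ν) := hF.comp_quasiMeasurePreserving mp.quasiMeasurePreserving
    have hGK : ∀ p, |G p| ≤ K := fun p => hK _
    have hGi : Integrable G (Q.prod ν) :=
      Integrable.of_bound hGm.aestronglyMeasurable K (.of_forall fun p => hGK p)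
    have hde : ∀ a r i b, |G (a, Function.update r i b) - G (a, r)| ≤ c := by
      intro a r i b
      have : e (a, Function.update r i b) = Function.update (e (a, r)) i.succ b := by
        rw [he_cons, he_cons, Fin.cons_update]
      simpa [hG, this] using hd (e (a, r)) i.succ b
    have hde0 : ∀ a b r, |G (b, r) - G (a, r)| ≤ c := by
      intro a b r
      have : e (b, r) = Function.update (e (a, r)) 0 b := by
        rw [he_cons, he_cons, Fin.update_cons_zero]
      simpa [hG, this] using hd (e (a, r)) 0 b
    set g : X → ℝ := fun a => ∫ r, G (a, r) ∂ν with hg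
    have hgm : AEMeasurable g Q :=
      (hGm.aestronglyMeasurable.integral_prod_right').aemeasurable
    have hgood : ∀ᵐ a ∂Q, AEMeasurable (fun r => G (a, r)) ν := by
      filter_upwards [hGm.aestronglyMeasurable.prodMk_left] with a ha using ha.aemeasurable
    have hint : ∀ a, AEMeasurable (fun r => G (a, r)) ν → Integrable (fun r => G (a, r)) ν :=
      fun a ha => Integrable.of_bound ha.aestronglyMeasurable K (.of_forall fun r => hGK _)
    -- Off `S` the integral `g a` is the default 0, so values of `g` are compared only on `S`, which
    -- has full measure.
    set S : Set X := {a | AEMeasurable (fun r => G (a, r)) ν} with hS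
    have hgS : ∀ a ∈ S, ∀ b ∈ S, g b ≤ g a + c := by
      intro a ha b hb
      have : g b ≤ ∫ r, (G (a, r) + c) ∂ν := by
        refine integral_mono (hint b hb) ((hint a ha).add (integrable_const c)) fun r => ?_
        have := (abs_le.1 (hde0 a b r)).2
        simp only
        linarith
      rwa [integral_add (hint a ha) (integrable_const c), integral_const, probReal_univ,
        one_smul] at this
    have hIcc : ∃ lo, ∀ᵐ a ∂Q, g a ∈ Set.Icc lo (lo + c) := by
      obtain ⟨a₀, ha₀⟩ := hgood.exists
      have hbdd : BddBelow (g '' S) := by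
        refine ⟨g a₀ - c, ?_⟩
        rintro _ ⟨a, ha, rfl⟩
        linarith [hgS a ha a₀ ha₀]
      refine ⟨sInf (g '' S), ?_⟩
      filter_upwards [hgood] with a ha
      refine ⟨csInf_le hbdd ⟨a, ha, rfl⟩, ?_⟩
      have : g a - c ≤ sInf (g '' S) := by
        refine le_csInf ⟨_, a₀, ha₀, rfl⟩ ?_
        rintro _ ⟨b, hb, rfl⟩
        linarith [hgS b hb a ha]
      linarith
    obtain ⟨lo, hlo⟩ := hIcc
    -- Hoeffding's lemma: the conditional mean given the first coordinate lies a.s. in an interval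
    -- of length `c`, which yields the factor exp(c²t²/8).
    have hsub := hasSubgaussianMGF_of_mem_Icc hgm hlo
    have hmean : ∫ y, F y ∂(Measure.pi fun _ => Q) = ∫ a, g a ∂Q := by
      rw [← mp.integral_comp' (g := F), integral_prod _ hGi]
    set m := ∫ a, g a ∂Q with hm
    have hexpm : AEMeasurable (fun p => Real.exp (t * (G p - m))) (Q.prod ν) :=
      Real.measurable_exp.comp_aemeasurable ((hGm.sub_const m).const_mul t)
    have hexpi : Integrable (fun p => Real.exp (t * (G p - m))) (Q.prod ν) := by
      refine Integrable.of_bound hexpm.aestronglyMeasurable (Real.exp (|t| * (K + |m|)))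
        (.of_forall fun p => ?_)
      rw [Real.norm_eq_abs, Real.abs_exp, Real.exp_le_exp]
      calc t * (G p - m) ≤ |t * (G p - m)| := le_abs_self _
        _ = |t| * |G p - m| := abs_mul _ _
        _ ≤ |t| * (K + |m|) := by
          gcongr
          exact (abs_sub _ _).trans (add_le_add (hGK p) le_rfl)
    rw [hmean, ← mp.integral_comp' (g := fun x => Real.exp (t * (F x - m)))]
    change ∫ p, Real.exp (t * (G p - m)) ∂(Q.prod ν) ≤ _
    rw [integral_prod _ hexpi]
    have hstep : ∀ᵐ a ∂Q, ∫ r, Real.exp (t * (G (a, r) - m)) ∂ν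
        ≤ Real.exp (n * (c ^ 2 * t ^ 2 / 8)) * Real.exp (t * (g a - m)) := by
      filter_upwards [hgood] with a ha
      have h1 := ih (fun r => G (a, r)) ha (fun r => hGK _) (fun r i b => hde a r i b)
      have h2 : ∀ r, Real.exp (t * (G (a, r) - m))
          = Real.exp (t * (G (a, r) - g a)) * Real.exp (t * (g a - m)) := fun r => by
        rw [← Real.exp_add]; ring_nf
      simp_rw [h2]
      rw [integral_mul_const]
      exact mul_le_mul_of_nonneg_right h1 (Real.exp_pos _).le
    refine (integral_mono_ae hexpi.integral_prod_left
      ((hsub.integrable_exp_mul t).const_mul _) hstep).trans ?_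
    rw [integral_const_mul]
    have h3 := hsub.mgf_le t
    rw [mgf] at h3
    refine (mul_le_mul_of_nonneg_left h3 (Real.exp_pos _).le).trans ?_
    rw [← Real.exp_add, Real.exp_le_exp]
    apply le_of_eq
    push_cast
    simp only [add_sub_cancel_left, Real.norm_eq_abs, div_pow, sq_abs]
    ring

/-- **McDiarmid's inequality** for i.i.d. variables. -/
theorem measureReal_ge_le_of_bounded_differences {n : ℕ} (hn : 0 < n) (F : (Fin n → X) → ℝ)
    (hF : AEMeasurable F (Measure.pi fun _ => Q)) {K c : ℝ} (hc : 0 < c) (hK : ∀ x, |F x| ≤ K)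
    (hd : ∀ x i a, |F (Function.update x i a) - F x| ≤ c) {s : ℝ} (hs : 0 ≤ s) :
    (Measure.pi fun _ => Q).real {x | s ≤ F x - ∫ y, F y ∂(Measure.pi fun _ => Q)}
      ≤ Real.exp (-(2 * s ^ 2 / (n * c ^ 2))) := by
  set m := ∫ y, F y ∂(Measure.pi fun _ => Q) with hm
  -- This `t` minimizes the Chernoff exponent -ts + nc²t²/8.
  set t := 4 * s / (n * c ^ 2) with ht
  have hn' : (0 : ℝ) < n := by exact_mod_cast hn
  have hint : Integrable (fun x => Real.exp (t * (F x - m))) (Measure.pi fun _ => Q) := by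
    refine Integrable.of_bound (Real.measurable_exp.comp_aemeasurable
      ((hF.sub_const m).const_mul t)).aestronglyMeasurable (Real.exp (|t| * (K + |m|)))
      (.of_forall fun p => ?_)
    rw [Real.norm_eq_abs, Real.abs_exp, Real.exp_le_exp]
    calc t * (F p - m) ≤ |t * (F p - m)| := le_abs_self _
      _ = |t| * |F p - m| := abs_mul _ _
      _ ≤ |t| * (K + |m|) := by
        gcongr
        exact (abs_sub _ _).trans (add_le_add (hK p) le_rfl)
  refine (measure_ge_le_exp_mul_mgf s (by positivity : 0 ≤ t) hint).trans ?_
  rw [mgf]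
  refine (mul_le_mul_of_nonneg_left
    (integral_exp_le_of_bounded_differences Q n F hF hK hd t) (Real.exp_pos _).le).trans ?_
  rw [← Real.exp_add, Real.exp_le_exp]
  apply le_of_eq
  rw [ht]
  field_simp
  ring

end BoundedDifferences

theorem abs_iSup_sub_iSup_le {ι : Type*} {a b : ι → ℝ} {e : ℝ} (he : 0 ≤ e)
    (ha : BddAbove (Set.range a)) (hb : BddAbove (Set.range b)) (h : ∀ i, |a i - b i| ≤ e) :
    |(⨆ i, a i) - ⨆ i, b i| ≤ e := by
  rcases isEmpty_or_nonempty ι with hι | hι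
  · simpa [Real.iSup_of_isEmpty] using he
  · have h1 : ⨆ i, a i ≤ (⨆ i, b i) + e :=
      ciSup_le fun i => by linarith [(abs_le.1 (h i)).2, le_ciSup hb i]
    have h2 : ⨆ i, b i ≤ (⨆ i, a i) + e :=
      ciSup_le fun i => by linarith [(abs_le.1 (h i)).1, le_ciSup ha i]
    rw [abs_le]
    constructor <;> linarith

/-! ### Random sign vectors with prescribed means. -/

section Signs

variable {n : ℕ}

theorem abs_sign_cast (s : ℤˣ) : |((s : ℤ) : ℝ)| = 1 := by
  rcases Int.units_eq_one_or s with rfl | rfl <;> simp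

theorem sum_prod_signs (g : Fin n → ℤˣ → ℝ) :
    ∑ ε : Fin n → ℤˣ, ∏ i, g i (ε i) = ∏ i, (g i 1 + g i (-1)) := by
  have h := Finset.prod_univ_sum (fun _ : Fin n => (Finset.univ : Finset ℤˣ)) g
  rw [Fintype.piFinset_univ] at h
  rw [← h]
  refine Finset.prod_congr rfl fun i _ => ?_
  rw [UnitsInt.univ, Finset.sum_pair (by decide)]

/-- The probability of the sign vector `ε` when its coordinates are independent with means `t i`. -/
noncomputable def signWeight (t : Fin n → ℝ) (ε : Fin n → ℤˣ) : ℝ :=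
  ∏ i, (1 + ((ε i : ℤ) : ℝ) * t i) / 2

theorem signWeight_nonneg {t : Fin n → ℝ} (ht : ∀ i, |t i| ≤ 1) (ε : Fin n → ℤˣ) :
    0 ≤ signWeight t ε := by
  refine Finset.prod_nonneg fun i _ => ?_
  have h : |((ε i : ℤ) : ℝ) * t i| ≤ 1 := by rw [abs_mul, abs_sign_cast, one_mul]; exact ht i
  linarith [(abs_le.1 h).1]

theorem sum_signWeight (t : Fin n → ℝ) : ∑ ε, signWeight t ε = 1 := by
  unfold signWeight
  rw [sum_prod_signs fun i s => (1 + ((s : ℤ) : ℝ) * t i) / 2]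
  refine Finset.prod_eq_one fun i _ => ?_
  push_cast
  ring

theorem sum_signWeight_mul_sign (t : Fin n → ℝ) (j : Fin n) :
    ∑ ε, signWeight t ε * ((ε j : ℤ) : ℝ) = t j := by
  -- The factor `ε j` is spread as a product over all coordinates, so that the sum over `ε`
  -- factorizes.
  have h : ∀ ε : Fin n → ℤˣ, signWeight t ε * ((ε j : ℤ) : ℝ)
      = ∏ i, (1 + ((ε i : ℤ) : ℝ) * t i) / 2 * (if i = j then ((ε i : ℤ) : ℝ) else 1) := by
    intro ε
    rw [Finset.prod_mul_distrib, Finset.prod_ite_eq' Finset.univ j]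
    simp [signWeight]
  simp_rw [h]
  rw [sum_prod_signs
    fun i s => (1 + ((s : ℤ) : ℝ) * t i) / 2 * (if i = j then ((s : ℤ) : ℝ) else 1)]
  rw [Finset.prod_eq_single j]
  · simp; ring
  · intro i _ hij
    simp [hij]
    ring
  · simp

theorem sum_signs_eq_zero_of_flip (j : Fin n) (g : (Fin n → ℤˣ) → ℝ)
    (hg : ∀ ε, g (ε * Pi.mulSingle j (-1)) = -g ε) : ∑ ε, g ε = 0 := by
  have h := Equiv.sum_comp (Equiv.mulRight (Pi.mulSingle j (-1) : Fin n → ℤˣ)) g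
  simp only [Equiv.coe_mulRight, hg, Finset.sum_neg_distrib] at h
  linarith

theorem card_signs : (Fintype.card (Fin n → ℤˣ) : ℝ) = 2 ^ n := by
  simp

end Signs

/-! ### Signed suprema and their weighted averages. -/

section SignedSup

variable {X : Type*} {n : ℕ} {C : Set (X → ℝ)}

theorem abs_signed_sum_le {s : Finset (Fin n)} {a : Fin n → ℝ} (ha : ∀ i, |a i| ≤ 1)
    (σ : Fin n → ℤˣ) : |1 / (n : ℝ) * ∑ i ∈ s, ((σ i : ℤ) : ℝ) * a i| ≤ 1 := by
  have h : |∑ i ∈ s, ((σ i : ℤ) : ℝ) * a i| ≤ n := by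
    refine (Finset.abs_sum_le_sum_abs _ _).trans ?_
    calc ∑ i ∈ s, |((σ i : ℤ) : ℝ) * a i| ≤ ∑ i ∈ s, (1 : ℝ) :=
          Finset.sum_le_sum fun i _ => by rw [abs_mul, abs_sign_cast, one_mul]; exact ha i
      _ = (s.card : ℝ) := by simp
      _ ≤ n := by exact_mod_cast (Finset.card_le_univ s).trans (by simp)
  rw [abs_mul, abs_of_nonneg (by positivity : (0 : ℝ) ≤ 1 / n)]
  rcases Nat.eq_zero_or_pos n with rfl | hn
  · simp
  · have hn' : (0 : ℝ) < n := by exact_mod_cast hn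
    rw [div_mul_eq_mul_div, one_mul, div_le_one hn']
    exact h

/-- The supremum `signedSup` with the terms outside `s` left out. -/
noncomputable def signedSupOn (C : Set (X → ℝ)) (s : Finset (Fin n)) (σ : Fin n → ℤˣ)
    (x : Fin n → X) : ℝ :=
  ⨆ c : C, 1 / (n : ℝ) * ∑ i ∈ s, ((σ i : ℤ) : ℝ) * c.1 (x i)

theorem signedSupOn_univ (σ : Fin n → ℤˣ) (x : Fin n → X) :
    signedSupOn C Finset.univ σ x = signedSup C σ x := rfl

theorem bddAbove_signedSupOn (hC : ∀ c ∈ C, ∀ x, |c x| ≤ 1) (s : Finset (Fin n))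
    (σ : Fin n → ℤˣ) (x : Fin n → X) :
    BddAbove (Set.range fun c : C => 1 / (n : ℝ) * ∑ i ∈ s, ((σ i : ℤ) : ℝ) * c.1 (x i)) := by
  refine ⟨1, ?_⟩
  rintro _ ⟨c, rfl⟩
  exact (abs_le.1 (abs_signed_sum_le (fun i => hC c.1 c.2 (x i)) σ)).2

theorem abs_signedSup_le (hC : ∀ c ∈ C, ∀ x, |c x| ≤ 1) (σ : Fin n → ℤˣ) (x : Fin n → X) :
    |signedSup C σ x| ≤ 1 := by
  have h0 : (⨆ _ : C, (0 : ℝ)) = 0 := by simp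
  have h := abs_iSup_sub_iSup_le zero_le_one (bddAbove_signedSupOn hC Finset.univ σ x)
    (b := fun _ : C => (0 : ℝ)) ⟨0, by rintro _ ⟨_, rfl⟩; exact le_rfl⟩
    (fun c => by simpa using abs_signed_sum_le (fun i => hC c.1 c.2 (x i)) σ)
  rwa [h0, sub_zero] at h

/-- The signs `σ` and `-σ` are paired: any single `c` contributes opposite values to the two
suprema. -/
theorem sum_signedSup_nonneg (hC : ∀ c ∈ C, ∀ x, |c x| ≤ 1) (x : Fin n → X) :
    0 ≤ ∑ σ : Fin n → ℤˣ, signedSup C σ x := by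
  have h := Equiv.sum_comp (Equiv.neg (Fin n → ℤˣ)) fun σ => signedSup C σ x
  have h2 : 0 ≤ ∑ σ : Fin n → ℤˣ, (signedSup C σ x + signedSup C (-σ) x) := by
    refine Finset.sum_nonneg fun σ _ => ?_
    rcases isEmpty_or_nonempty C with hE | ⟨⟨c⟩⟩
    · simp [signedSup, Real.iSup_of_isEmpty]
    · have h1 := le_ciSup (bddAbove_signedSupOn hC Finset.univ σ x) c
      have h2 := le_ciSup (bddAbove_signedSupOn hC Finset.univ (-σ) x) c
      simp only [Pi.neg_apply, Units.val_neg, Int.cast_neg, neg_mul, Finset.sum_neg_distrib,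
        mul_neg] at h1 h2
      change _ ≤ signedSup C σ x at h1
      change _ ≤ ⨆ c : C, _ at h2
      have h3 : (⨆ c : C, 1 / (n : ℝ) * ∑ i, (((-σ) i : ℤ) : ℝ) * c.1 (x i))
        = signedSup C (-σ) x := rfl
      simp only [Pi.neg_apply, Units.val_neg, Int.cast_neg, neg_mul, Finset.sum_neg_distrib,
        mul_neg] at h3
      rw [h3] at h2
      linarith
  rw [Finset.sum_add_distrib] at h2
  simp only [Equiv.neg_apply] at h
  linarith

theorem rademacherComplexity_nonneg [MeasurableSpace X] (hC : ∀ c ∈ C, ∀ x, |c x| ≤ 1)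
    (P : Measure X) : 0 ≤ rademacherComplexity n C P :=
  integral_nonneg fun x => mul_nonneg (by positivity) (sum_signedSup_nonneg hC x)

/-- The multilinear extension of `σ ↦ signedSup C σ x` to vectors `σ * t` with `t ∈ [-1, 1]ⁿ`,
evaluated at `t i = h (x i)`. -/
noncomputable def weightedSup (C : Set (X → ℝ)) (h : X → ℝ) (σ : Fin n → ℤˣ) (x : Fin n → X) : ℝ :=
  ∑ ε, signWeight (fun i => h (x i)) ε * signedSup C (σ * ε) x

variable {h : X → ℝ}

theorem abs_sum_signWeight_mul_le {t : Fin n → ℝ} (ht : ∀ i, |t i| ≤ 1) {e : ℝ}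
    {g : (Fin n → ℤˣ) → ℝ} (hg : ∀ ε, |g ε| ≤ e) : |∑ ε, signWeight t ε * g ε| ≤ e := by
  refine (Finset.abs_sum_le_sum_abs _ _).trans ?_
  calc ∑ ε, |signWeight t ε * g ε| ≤ ∑ ε, signWeight t ε * e := by
        refine Finset.sum_le_sum fun ε _ => ?_
        rw [abs_mul, abs_of_nonneg (signWeight_nonneg ht ε)]
        exact mul_le_mul_of_nonneg_left (hg ε) (signWeight_nonneg ht ε)
    _ = e := by rw [← Finset.sum_mul, sum_signWeight, one_mul]

theorem abs_weightedSup_le (hC : ∀ c ∈ C, ∀ x, |c x| ≤ 1) (hh : ∀ x, |h x| ≤ 1)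
    (σ : Fin n → ℤˣ) (x : Fin n → X) : |weightedSup C h σ x| ≤ 1 :=
  abs_sum_signWeight_mul_le (fun i => hh (x i)) fun _ => abs_signedSup_le hC _ x

/-- By `sum_signWeight_mul_sign` the left side is the `signWeight`-average of the sums with signs `σ
* ε`, and each of these is at most its supremum. -/
theorem signed_sum_le_weightedSup (hC : ∀ c ∈ C, ∀ x, |c x| ≤ 1) (hh : ∀ x, |h x| ≤ 1)
    {c : X → ℝ} (hc : c ∈ C) (σ : Fin n → ℤˣ) (x : Fin n → X) :
    1 / (n : ℝ) * ∑ i, ((σ i : ℤ) : ℝ) * (h (x i) * c (x i)) ≤ weightedSup C h σ x := by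
  have key : 1 / (n : ℝ) * ∑ i, ((σ i : ℤ) : ℝ) * (h (x i) * c (x i))
      = ∑ ε, signWeight (fun i => h (x i)) ε
          * (1 / (n : ℝ) * ∑ i, (((σ * ε) i : ℤ) : ℝ) * c (x i)) := by
    have h1 : ∀ ε : Fin n → ℤˣ, signWeight (fun i => h (x i)) ε
          * (1 / (n : ℝ) * ∑ i, (((σ * ε) i : ℤ) : ℝ) * c (x i))
        = 1 / (n : ℝ) * ∑ i, ((σ i : ℤ) : ℝ) * c (x i)
          * (signWeight (fun i => h (x i)) ε * ((ε i : ℤ) : ℝ)) := by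
      intro ε
      rw [mul_left_comm, Finset.mul_sum]
      congr 1
      refine Finset.sum_congr rfl fun i _ => ?_
      simp only [Pi.mul_apply, Units.val_mul, Int.cast_mul]
      ring
    simp_rw [h1]
    rw [← Finset.mul_sum, Finset.sum_comm]
    simp_rw [← Finset.mul_sum, sum_signWeight_mul_sign]
    congr 1
    refine Finset.sum_congr rfl fun i _ => by ring
  rw [key]
  refine Finset.sum_le_sum fun ε _ => mul_le_mul_of_nonneg_left ?_
    (signWeight_nonneg (fun i => hh (x i)) ε)
  exact le_ciSup (bddAbove_signedSupOn hC Finset.univ (σ * ε) x) ⟨c, hc⟩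

/-- For each `ε`, multiplication by `ε` permutes the sign vectors, and the weights sum to 1. This
removes `h` from the complexity term. -/
theorem sum_weightedSup (x : Fin n → X) :
    ∑ σ : Fin n → ℤˣ, weightedSup C h σ x = ∑ σ : Fin n → ℤˣ, signedSup C σ x := by
  unfold weightedSup
  rw [Finset.sum_comm]
  have : ∀ ε : Fin n → ℤˣ, ∑ σ : Fin n → ℤˣ, signWeight (fun i => h (x i)) ε
      * signedSup C (σ * ε) x
      = signWeight (fun i => h (x i)) ε * ∑ σ : Fin n → ℤˣ, signedSup C σ x := by
    intro ε
    rw [← Finset.mul_sum]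
    congr 1
    exact Equiv.sum_comp (Equiv.mulRight ε) fun σ => signedSup C σ x
  simp_rw [this]
  rw [← Finset.sum_mul, sum_signWeight, one_mul]

theorem aemeasurable_weightedSup [MeasurableSpace X] {Q : Measure X} [IsProbabilityMeasure Q]
    (hm : Measurable h) (hCm : RademacherMeasurable n C Q) (σ : Fin n → ℤˣ) :
    AEMeasurable (weightedSup C h σ) (Measure.pi fun _ : Fin n => Q) := by
  refine Finset.aemeasurable_fun_sum _ fun ε _ => AEMeasurable.mul ?_ (hCm (σ * ε))
  refine Measurable.aemeasurable (Finset.measurable_fun_prod _ fun i _ => ?_)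
  exact ((hm.comp (measurable_pi_apply i)).const_mul _).const_add _ |>.div_const _

/-- `weightedSup` with the coordinate `i` of the sample left out. -/
noncomputable def weightedSupErase (C : Set (X → ℝ)) (h : X → ℝ) (σ : Fin n → ℤˣ) (i : Fin n)
    (x : Fin n → X) : ℝ :=
  ∑ ε : Fin n → ℤˣ, 1 / 2 * (∏ j ∈ Finset.univ.erase i, (1 + ((ε j : ℤ) : ℝ) * h (x j)) / 2)
    * signedSupOn C (Finset.univ.erase i) (σ * ε) x

theorem weightedSupErase_update (σ : Fin n → ℤˣ) (i : Fin n) (x : Fin n → X) (a : X) :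
    weightedSupErase C h σ i (Function.update x i a) = weightedSupErase C h σ i x := by
  unfold weightedSupErase signedSupOn
  refine Finset.sum_congr rfl fun ε _ => ?_
  congr 2
  · refine Finset.prod_congr rfl fun j hj => ?_
    rw [Function.update_of_ne (Finset.ne_of_mem_erase hj)]
  · funext c
    congr 1
    refine Finset.sum_congr rfl fun j hj => ?_
    rw [Function.update_of_ne (Finset.ne_of_mem_erase hj)]

/-- The supremum without coordinate `i` does not depend on `ε i`, so the bias of that sign is
irrelevant: the difference of the summands is odd under flipping `ε i`. -/
theorem weightedSupErase_eq (σ : Fin n → ℤˣ) (i : Fin n) (x : Fin n → X) :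
    weightedSupErase C h σ i x = ∑ ε, signWeight (fun j => h (x j)) ε
      * signedSupOn C (Finset.univ.erase i) (σ * ε) x := by
  have hflip : ∀ ε : Fin n → ℤˣ, ∀ j ∈ Finset.univ.erase i,
      (ε * Pi.mulSingle i (-1) : Fin n → ℤˣ) j = ε j := fun ε j hj => by
    simp [Pi.mulSingle_eq_of_ne (Finset.ne_of_mem_erase hj)]
  rw [← sub_eq_zero, weightedSupErase, ← Finset.sum_sub_distrib]
  have hw : ∀ ε : Fin n → ℤˣ, signWeight (fun j => h (x j)) ε = (1 + ((ε i : ℤ) : ℝ) * h (x i)) / 2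
      * ∏ j ∈ Finset.univ.erase i, (1 + ((ε j : ℤ) : ℝ) * h (x j)) / 2 := fun ε =>
    (Finset.mul_prod_erase _ _ (Finset.mem_univ i)).symm
  refine sum_signs_eq_zero_of_flip i _ fun ε => ?_
  have h1 : ∏ j ∈ Finset.univ.erase i,
        (1 + (((ε * Pi.mulSingle i (-1) : Fin n → ℤˣ) j : ℤ) : ℝ) * h (x j)) / 2
      = ∏ j ∈ Finset.univ.erase i, (1 + ((ε j : ℤ) : ℝ) * h (x j)) / 2 :=
    Finset.prod_congr rfl fun j hj => by rw [hflip ε j hj]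
  have h2 : signedSupOn C (Finset.univ.erase i) (σ * (ε * Pi.mulSingle i (-1))) x
      = signedSupOn C (Finset.univ.erase i) (σ * ε) x := by
    unfold signedSupOn
    congr 1
    funext c
    congr 1
    refine Finset.sum_congr rfl fun j hj => ?_
    rw [Pi.mul_apply, hflip ε j hj, Pi.mul_apply]
  rw [hw, hw, h1, h2]
  simp
  ring

theorem abs_weightedSup_sub_erase_le (hC : ∀ c ∈ C, ∀ x, |c x| ≤ 1) (hh : ∀ x, |h x| ≤ 1)
    (σ : Fin n → ℤˣ) (i : Fin n) (x : Fin n → X) :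
    |weightedSup C h σ x - weightedSupErase C h σ i x| ≤ 1 / n := by
  rw [weightedSupErase_eq, weightedSup, ← Finset.sum_sub_distrib]
  simp_rw [← mul_sub]
  refine abs_sum_signWeight_mul_le (fun j => hh (x j)) fun ε => ?_
  rw [← signedSupOn_univ]
  refine abs_iSup_sub_iSup_le (by positivity) (bddAbove_signedSupOn hC _ _ _)
    (bddAbove_signedSupOn hC _ _ _) fun c => ?_
  rw [← mul_sub, ← Finset.add_sum_erase _ _ (Finset.mem_univ i), add_sub_cancel_right, abs_mul,
    abs_mul, abs_sign_cast, one_mul, abs_of_nonneg (by positivity : (0 : ℝ) ≤ 1 / n)]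
  exact mul_le_of_le_one_right (by positivity) (hC c.1 c.2 _)

/-- Changing `x i` moves the weights as well as the suprema. Both values are within 1/n of
`weightedSupErase`, which does not see coordinate `i`. -/
theorem abs_weightedSup_update_sub_le (hC : ∀ c ∈ C, ∀ x, |c x| ≤ 1) (hh : ∀ x, |h x| ≤ 1)
    (σ : Fin n → ℤˣ) (x : Fin n → X) (i : Fin n) (a : X) :
    |weightedSup C h σ (Function.update x i a) - weightedSup C h σ x| ≤ 2 / n := by
  have h1 := abs_weightedSup_sub_erase_le hC hh σ i (Function.update x i a)
  rw [weightedSupErase_update] at h1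
  have h2 := abs_weightedSup_sub_erase_le hC hh σ i x
  have h3 : (2 : ℝ) / n = 1 / n + 1 / n := by ring
  rw [abs_le] at *
  constructor <;> linarith

end SignedSup

/-! ### Symmetrization by a ghost sample and the one-sided uniform bound. -/

section Symmetrization

variable {X : Type*} {n : ℕ} {C : Set (X → ℝ)} {h : X → ℝ}

/-- The sample that takes its coordinate `i` from `p.1` if `σ i = 1` and from `p.2` otherwise. -/
def signMix (σ : Fin n → ℤˣ) (p : (Fin n → X) × (Fin n → X)) : Fin n → X :=
  fun i => if σ i = 1 then p.1 i else p.2 i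

theorem measurePreserving_signMix [MeasurableSpace X] (Q : Measure X) [IsProbabilityMeasure Q]
    (σ : Fin n → ℤˣ) :
    MeasurePreserving (signMix σ)
      ((Measure.pi fun _ : Fin n => Q).prod (Measure.pi fun _ : Fin n => Q))
      (Measure.pi fun _ : Fin n => Q) := by
  have hm : Measurable (signMix (X := X) σ) := by
    refine measurable_pi_lambda _ fun i => ?_
    by_cases hi : σ i = 1
    · simpa [signMix, hi, Function.comp_def] using (measurable_pi_apply i).comp measurable_fst
    · simpa [signMix, hi, Function.comp_def] using (measurable_pi_apply i).comp measurable_snd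
  refine ⟨hm, (Measure.pi_eq fun s hs => ?_).symm⟩
  rw [Measure.map_apply hm (MeasurableSet.univ_pi hs)]
  have hpre : signMix (X := X) σ ⁻¹' Set.univ.pi s
      = (Set.univ.pi fun i => if σ i = 1 then s i else Set.univ)
        ×ˢ (Set.univ.pi fun i => if σ i = 1 then Set.univ else s i) := by
    ext p
    simp only [Set.mem_preimage, Set.mem_pi, Set.mem_univ, true_implies, Set.mem_prod, signMix]
    rw [← forall_and]
    refine forall_congr' fun i => ?_
    by_cases hi : σ i = 1 <;> simp [hi]
  rw [hpre, Measure.prod_prod, Measure.pi_pi, Measure.pi_pi, ← Finset.prod_mul_distrib]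
  refine Finset.prod_congr rfl fun i _ => ?_
  by_cases hi : σ i = 1 <;> simp [hi]

/-- A bound for the difference of the empirical means of `h * c` over two samples, uniform over
`c ∈ C`. -/
noncomputable def symmetrizedBound (C : Set (X → ℝ)) (h : X → ℝ)
    (p : (Fin n → X) × (Fin n → X)) : ℝ :=
  1 / 2 ^ n * ∑ σ : Fin n → ℤˣ,
    (weightedSup C h σ (signMix σ p) + weightedSup C h (-σ) (signMix (-σ) p))

theorem abs_mean_signs_le {e : ℝ} {g : (Fin n → ℤˣ) → ℝ} (hg : ∀ σ, |g σ| ≤ e) :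
    |1 / 2 ^ n * ∑ σ, g σ| ≤ e := by
  have h1 : |∑ σ, g σ| ≤ 2 ^ n * e := by
    refine (Finset.abs_sum_le_sum_abs _ _).trans ((Finset.sum_le_sum fun σ _ => hg σ).trans ?_)
    rw [Finset.sum_const, nsmul_eq_mul, Finset.card_univ, card_signs]
  rw [abs_mul, abs_of_pos (by positivity : (0 : ℝ) < 1 / 2 ^ n), div_mul_eq_mul_div, one_mul,
    div_le_iff₀ (by positivity)]
  linarith

theorem abs_symmetrizedBound_le (hC : ∀ c ∈ C, ∀ x, |c x| ≤ 1) (hh : ∀ x, |h x| ≤ 1)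
    (p : (Fin n → X) × (Fin n → X)) : |symmetrizedBound C h p| ≤ 2 :=
  abs_mean_signs_le fun σ => (abs_add_le _ _).trans <| by
    linarith [abs_weightedSup_le hC hh σ (signMix σ p),
      abs_weightedSup_le hC hh (-σ) (signMix (-σ) p)]

theorem signMix_update (σ : Fin n → ℤˣ) (x y : Fin n → X) (i : Fin n) (a : X) :
    signMix σ (Function.update x i a, y)
      = if σ i = 1 then Function.update (signMix σ (x, y)) i a else signMix σ (x, y) := by
  funext j
  rcases eq_or_ne j i with rfl | hj
  · by_cases hi : σ j = 1 <;> simp [signMix, hi]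
  · by_cases hi : σ i = 1 <;> simp [signMix, hi, hj]

/-- For each `σ`, the point `x i` enters exactly one of the mixes for `σ` and `-σ`; hence 2/n and
not 4/n. -/
theorem abs_symmetrizedBound_update_sub_le (hC : ∀ c ∈ C, ∀ x, |c x| ≤ 1)
    (hh : ∀ x, |h x| ≤ 1) (x y : Fin n → X) (i : Fin n) (a : X) :
    |symmetrizedBound C h (Function.update x i a, y) - symmetrizedBound C h (x, y)| ≤ 2 / n := by
  rw [symmetrizedBound, symmetrizedBound, ← mul_sub, ← Finset.sum_sub_distrib]
  refine abs_mean_signs_le fun σ => ?_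
  rw [signMix_update, signMix_update]
  rcases Int.units_eq_one_or (σ i) with hi | hi
  · have hi' : ¬ (-σ) i = 1 := by rw [Pi.neg_apply, hi]; decide
    rw [if_pos hi, if_neg hi', add_sub_add_right_eq_sub]
    exact abs_weightedSup_update_sub_le hC hh _ _ _ _
  · have hi' : (-σ) i = 1 := by rw [Pi.neg_apply, hi]; decide
    have hi2 : ¬ σ i = 1 := by rw [hi]; decide
    rw [if_pos hi', if_neg hi2, add_sub_add_left_eq_sub]
    exact abs_weightedSup_update_sub_le hC hh _ _ _ _

/-- For every `σ`, the signed sums over the two complementary mixes add up to the left side: each `x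
i` occurs once with sign +1 and each `y i` once with sign -1. -/
theorem mean_sub_mean_le_symmetrizedBound (hC : ∀ c ∈ C, ∀ x, |c x| ≤ 1)
    (hh : ∀ x, |h x| ≤ 1) {c : X → ℝ} (hc : c ∈ C) (x y : Fin n → X) :
    1 / (n : ℝ) * ∑ i, h (x i) * c (x i) - 1 / (n : ℝ) * ∑ i, h (y i) * c (y i)
      ≤ symmetrizedBound C h (x, y) := by
  refine le_trans ((le_div_iff₀ (by positivity : (0 : ℝ) < 2 ^ n)).2 ?_)
    (one_div_mul_eq_div _ _).ge
  rw [mul_comm, ← card_signs (n := n), ← Finset.card_univ, ← nsmul_eq_mul]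
  refine Finset.card_nsmul_le_sum _ _ _ fun σ _ => ?_
  have h1 := signed_sum_le_weightedSup hC hh hc σ (signMix σ (x, y))
  have h2 := signed_sum_le_weightedSup hC hh hc (-σ) (signMix (-σ) (x, y))
  refine le_trans (le_of_eq ?_) (add_le_add h1 h2)
  rw [← mul_sub, ← mul_add, ← Finset.sum_sub_distrib, ← Finset.sum_add_distrib]
  congr 1
  refine Finset.sum_congr rfl fun i _ => ?_
  rcases Int.units_eq_one_or (σ i) with hi | hi
  · have hi' : ¬ (-1 : ℤˣ) = 1 := by decide
    simp only [signMix, Pi.neg_apply, hi, hi', if_true, if_false]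
    push_cast
    ring
  · have hi' : ¬ (-1 : ℤˣ) = 1 := by decide
    simp only [signMix, Pi.neg_apply, hi, hi', neg_neg, if_true, if_false]
    push_cast
    ring

variable [MeasurableSpace X] {Q : Measure X} [IsProbabilityMeasure Q]

theorem aemeasurable_symmetrizedBound (hm : Measurable h) (hCm : RademacherMeasurable n C Q) :
    AEMeasurable (symmetrizedBound (n := n) C h)
      ((Measure.pi fun _ : Fin n => Q).prod (Measure.pi fun _ : Fin n => Q)) := by
  refine AEMeasurable.const_mul (Finset.aemeasurable_fun_sum _ fun σ _ => AEMeasurable.add ?_ ?_) _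
  · exact (aemeasurable_weightedSup hm hCm σ).comp_quasiMeasurePreserving
      (measurePreserving_signMix Q σ).quasiMeasurePreserving
  · exact (aemeasurable_weightedSup hm hCm (-σ)).comp_quasiMeasurePreserving
      (measurePreserving_signMix Q (-σ)).quasiMeasurePreserving

/-- Each mix is again an i.i.d. sample from `Q`, so both families of terms have the same total
expectation. -/
theorem integral_symmetrizedBound (hC : ∀ c ∈ C, ∀ x, |c x| ≤ 1) (hh : ∀ x, |h x| ≤ 1)
    (hm : Measurable h) (hCm : RademacherMeasurable n C Q) :
    ∫ p, symmetrizedBound C h p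
        ∂((Measure.pi fun _ : Fin n => Q).prod (Measure.pi fun _ : Fin n => Q))
      = 2 * rademacherComplexity n C Q := by
  set ν : Measure (Fin n → X) := Measure.pi fun _ => Q with hν
  have hi : ∀ σ : Fin n → ℤˣ, Integrable (weightedSup C h σ) ν := fun σ =>
    Integrable.of_bound (aemeasurable_weightedSup hm hCm σ).aestronglyMeasurable 1
      (.of_forall fun x => abs_weightedSup_le hC hh σ x)
  have hc : ∀ σ : Fin n → ℤˣ,
      ∫ p, weightedSup C h σ (signMix σ p) ∂(ν.prod ν) = ∫ x, weightedSup C h σ x ∂ν := by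
    intro σ
    have hmp := measurePreserving_signMix Q σ
    rw [← hν] at hmp
    conv_rhs => rw [← hmp.map_eq]
    refine (integral_map hmp.measurable.aemeasurable ?_).symm
    rw [hmp.map_eq]
    exact (hi σ).aestronglyMeasurable
  have hi' : ∀ σ : Fin n → ℤˣ, Integrable (fun p => weightedSup C h σ (signMix σ p)) (ν.prod ν) :=
    fun σ => (measurePreserving_signMix Q σ).integrable_comp_of_integrable (hi σ)
  unfold symmetrizedBound
  have hi2 : ∀ σ ∈ (Finset.univ : Finset (Fin n → ℤˣ)), Integrable (fun p =>
      weightedSup C h σ (signMix σ p) + weightedSup C h (-σ) (signMix (-σ) p)) (ν.prod ν) :=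
    fun σ _ => (hi' σ).add (hi' (-σ))
  rw [integral_const_mul, integral_finsetSum _ hi2]
  simp_rw [integral_add (hi' _) (hi' _), hc]
  have hneg : ∑ σ : Fin n → ℤˣ, ∫ x, weightedSup C h (-σ) x ∂ν
      = ∑ σ : Fin n → ℤˣ, ∫ x, weightedSup C h σ x ∂ν :=
    Equiv.sum_comp (Equiv.neg (Fin n → ℤˣ)) fun σ => ∫ x, weightedSup C h σ x ∂ν
  rw [Finset.sum_add_distrib, hneg, ← integral_finsetSum _ fun σ _ => hi σ]
  simp_rw [sum_weightedSup]
  unfold rademacherComplexity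
  rw [integral_const_mul]
  ring

/-- The mean of `symmetrizedBound` over its second sample, shifted by `2`. The lower integral keeps
its bounded differences at every point, also where the integrand is not measurable. -/
noncomputable def ghostBound (C : Set (X → ℝ)) (h : X → ℝ) (Q : Measure X) (x : Fin n → X) : ℝ :=
  (∫⁻ y, ENNReal.ofReal (symmetrizedBound C h (x, y) + 2)
    ∂(Measure.pi fun _ : Fin n => Q)).toReal

theorem lintegral_symmetrizedBound_le (hC : ∀ c ∈ C, ∀ x, |c x| ≤ 1) (hh : ∀ x, |h x| ≤ 1)
    (x : Fin n → X) : ∫⁻ y, ENNReal.ofReal (symmetrizedBound C h (x, y) + 2)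
      ∂(Measure.pi fun _ : Fin n => Q) ≤ ENNReal.ofReal 4 := by
  calc ∫⁻ y, ENNReal.ofReal (symmetrizedBound C h (x, y) + 2) ∂(Measure.pi fun _ : Fin n => Q)
      ≤ ∫⁻ _, ENNReal.ofReal 4 ∂(Measure.pi fun _ : Fin n => Q) :=
        lintegral_mono fun y => ENNReal.ofReal_le_ofReal (by
          linarith [(abs_le.1 (abs_symmetrizedBound_le hC hh (x, y))).2])
    _ = ENNReal.ofReal 4 := by simp

theorem abs_ghostBound_le (hC : ∀ c ∈ C, ∀ x, |c x| ≤ 1) (hh : ∀ x, |h x| ≤ 1)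
    (x : Fin n → X) : |ghostBound C h Q x| ≤ 4 := by
  rw [ghostBound, abs_of_nonneg ENNReal.toReal_nonneg]
  exact ENNReal.toReal_le_of_le_ofReal (by norm_num) (lintegral_symmetrizedBound_le hC hh x)

theorem ghostBound_le_add (hC : ∀ c ∈ C, ∀ x, |c x| ≤ 1) (hh : ∀ x, |h x| ≤ 1)
    {x x' : Fin n → X} {e : ℝ} (he : 0 ≤ e)
    (hx : ∀ y, symmetrizedBound C h (x, y) ≤ symmetrizedBound C h (x', y) + e) :
    ghostBound C h Q x ≤ ghostBound C h Q x' + e := by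
  have hfin := ((lintegral_symmetrizedBound_le (Q := Q) hC hh x').trans_lt
    ENNReal.ofReal_lt_top).ne
  have h1 : ∫⁻ y, ENNReal.ofReal (symmetrizedBound C h (x, y) + 2)
        ∂(Measure.pi fun _ : Fin n => Q)
      ≤ ∫⁻ y, ENNReal.ofReal (symmetrizedBound C h (x', y) + 2)
        ∂(Measure.pi fun _ : Fin n => Q) + ENNReal.ofReal e := by
    calc _ ≤ ∫⁻ y, (ENNReal.ofReal (symmetrizedBound C h (x', y) + 2) + ENNReal.ofReal e)
          ∂(Measure.pi fun _ : Fin n => Q) := by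
          refine lintegral_mono fun y => ?_
          rw [← ENNReal.ofReal_add
            (by linarith [(abs_le.1 (abs_symmetrizedBound_le hC hh (x', y))).1]) he]
          exact ENNReal.ofReal_le_ofReal (by linarith [hx y])
      _ = _ := by rw [lintegral_add_right _ measurable_const]; simp
  have h2 := ENNReal.toReal_mono (ENNReal.add_ne_top.2 ⟨hfin, ENNReal.ofReal_ne_top⟩) h1
  rwa [ENNReal.toReal_add hfin ENNReal.ofReal_ne_top, ENNReal.toReal_ofReal he] at h2

theorem abs_ghostBound_update_sub_le (hC : ∀ c ∈ C, ∀ x, |c x| ≤ 1) (hh : ∀ x, |h x| ≤ 1)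
    (x : Fin n → X) (i : Fin n) (a : X) :
    |ghostBound C h Q (Function.update x i a) - ghostBound C h Q x| ≤ 2 / n := by
  have hd := fun y => abs_le.1 (abs_symmetrizedBound_update_sub_le hC hh x y i a)
  have h1 := ghostBound_le_add (Q := Q) hC hh (e := 2 / n) (by positivity)
    fun y => sub_le_iff_le_add'.1 (hd y).2
  have h2 := ghostBound_le_add (Q := Q) hC hh (x := x) (x' := Function.update x i a)
    (e := 2 / n) (by positivity) fun y => by linarith [(hd y).1]
  rw [abs_le]
  constructor <;> linarith

theorem aemeasurable_ghostBound (hm : Measurable h) (hCm : RademacherMeasurable n C Q) :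
    AEMeasurable (ghostBound C h Q) (Measure.pi fun _ : Fin n => Q) :=
  (((aemeasurable_symmetrizedBound hm hCm).add_const 2).ennreal_ofReal.lintegral_prod_right'
    ).ennreal_toReal

theorem integral_ghostBound (hC : ∀ c ∈ C, ∀ x, |c x| ≤ 1) (hh : ∀ x, |h x| ≤ 1)
    (hm : Measurable h) (hCm : RademacherMeasurable n C Q) :
    ∫ x, ghostBound C h Q x ∂(Measure.pi fun _ : Fin n => Q)
      = 2 * rademacherComplexity n C Q + 2 := by
  have hB := aemeasurable_symmetrizedBound hm hCm
  have hB2 := (hB.add_const 2).ennreal_ofReal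
  unfold ghostBound
  rw [integral_toReal hB2.lintegral_prod_right' (.of_forall fun x =>
      (lintegral_symmetrizedBound_le hC hh x).trans_lt ENNReal.ofReal_lt_top),
    ← lintegral_prod _ hB2, ← integral_eq_lintegral_of_nonneg_ae
      (.of_forall fun p => by
        simpa using (by linarith [(abs_le.1 (abs_symmetrizedBound_le hC hh p)).1] :
          0 ≤ symmetrizedBound C h p + 2)) (hB.add_const 2).aestronglyMeasurable,
    integral_add (Integrable.of_bound hB.aestronglyMeasurable 2
      (.of_forall fun p => abs_symmetrizedBound_le hC hh p)) (integrable_const _),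
    integral_symmetrizedBound hC hh hm hCm]
  simp

/-- The comparison with a second sample `y` is integrated over `y`, whose empirical mean has
expectation `∫ z, h z * c z ∂Q`. -/
theorem mean_sub_integral_le_ghostBound (hn : 0 < n) (hC : ∀ c ∈ C, ∀ x, |c x| ≤ 1)
    (hh : ∀ x, |h x| ≤ 1) (hm : Measurable h) {c : X → ℝ} (hc : c ∈ C) (hcm : Measurable c)
    (x : Fin n → X) :
    1 / (n : ℝ) * ∑ i, h (x i) * c (x i) - ∫ z, h z * c z ∂Q ≤ ghostBound C h Q x - 2 := by
  set ν : Measure (Fin n → X) := Measure.pi fun _ => Q with hν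
  have hhc : Integrable (fun z => h z * c z) Q :=
    Integrable.of_bound (hm.mul hcm).aestronglyMeasurable 1 (.of_forall fun z => by
      rw [Real.norm_eq_abs, abs_mul]
      exact mul_le_one₀ (hh z) (abs_nonneg _) (hC c hc z))
  have hi : ∀ i : Fin n, Integrable (fun y : Fin n → X => h (y i) * c (y i)) ν := fun i =>
    (measurePreserving_eval (fun _ : Fin n => Q) i).integrable_comp_of_integrable hhc
  have hmean : ∫ y, 1 / (n : ℝ) * ∑ i, h (y i) * c (y i) ∂ν = ∫ z, h z * c z ∂Q := by
    rw [integral_const_mul, integral_finsetSum _ fun i _ => hi i]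
    have : ∀ i : Fin n, ∫ y : Fin n → X, h (y i) * c (y i) ∂ν = ∫ z, h z * c z ∂Q := fun i => by
      have hmp := measurePreserving_eval (fun _ : Fin n => Q) i
      rw [← hmp.map_eq]
      exact (integral_map hmp.measurable.aemeasurable
        (hm.mul hcm).aestronglyMeasurable (f := fun z => h z * c z)).symm
    simp_rw [this]
    have hn' : (n : ℝ) ≠ 0 := by exact_mod_cast hn.ne'
    simp [hn']
  set φ : (Fin n → X) → ℝ := fun y =>
    1 / (n : ℝ) * ∑ i, h (x i) * c (x i) - 1 / (n : ℝ) * ∑ i, h (y i) * c (y i) with hφ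
  have hSi : Integrable (fun y : Fin n → X => 1 / (n : ℝ) * ∑ i, h (y i) * c (y i)) ν :=
    (integrable_finsetSum _ fun i _ => hi i).const_mul _
  have hφi : Integrable φ ν := (integrable_const _).sub hSi
  have hφint : ∫ y, (φ y + 2) ∂ν
      = 1 / (n : ℝ) * ∑ i, h (x i) * c (x i) - ∫ z, h z * c z ∂Q + 2 := by
    rw [integral_add hφi (integrable_const _), hφ, integral_sub (integrable_const _) hSi, hmean]
    simp
  have habs : ∀ y : Fin n → X, |1 / (n : ℝ) * ∑ i, h (y i) * c (y i)| ≤ 1 := fun y => by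
    simpa using abs_signed_sum_le (s := Finset.univ) (a := fun i => h (y i) * c (y i)) (fun i => by
      rw [abs_mul]
      exact mul_le_one₀ (hh _) (abs_nonneg _) (hC c hc _)) 1
  have hφ0 : ∀ y, 0 ≤ φ y + 2 := fun y => by
    have h1 := abs_le.1 (habs x)
    have h2 := abs_le.1 (habs y)
    simp only [hφ]
    linarith [h1.1, h2.2]
  -- Monotonicity of the lower integral needs no measurability of the section of `symmetrizedBound`
  -- at this `x`.
  have hle : ∫⁻ y, ENNReal.ofReal (φ y + 2) ∂ν
      ≤ ∫⁻ y, ENNReal.ofReal (symmetrizedBound C h (x, y) + 2) ∂ν :=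
    lintegral_mono fun y => ENNReal.ofReal_le_ofReal <|
      add_le_add (mean_sub_mean_le_symmetrizedBound hC hh hc x y) le_rfl
  have h3 := ENNReal.toReal_mono ((lintegral_symmetrizedBound_le (Q := Q) hC hh x).trans_lt
    ENNReal.ofReal_lt_top).ne hle
  rw [← integral_eq_lintegral_of_nonneg_ae (.of_forall hφ0)
    (hφi.add (integrable_const _)).aestronglyMeasurable, hφint] at h3
  unfold ghostBound
  linarith

/-- The uniform one-sided deviation bound for the class `{h * c | c ∈ C}`. -/
theorem measureReal_uniform_deviation_le (hn : 0 < n) (hC : ∀ c ∈ C, ∀ x, |c x| ≤ 1)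
    (hCmeas : ∀ c ∈ C, Measurable c) (hh : ∀ x, |h x| ≤ 1) (hm : Measurable h)
    (hCm : RademacherMeasurable n C Q) {s : ℝ} (hs : 0 ≤ s) :
    (Measure.pi fun _ : Fin n => Q).real {x | ∃ c ∈ C, 2 * rademacherComplexity n C Q + s
        < 1 / (n : ℝ) * ∑ i, h (x i) * c (x i) - ∫ z, h z * c z ∂Q}
      ≤ Real.exp (-(n * s ^ 2 / 2)) := by
  have hn' : (0 : ℝ) < n := by exact_mod_cast hn
  have key := measureReal_ge_le_of_bounded_differences Q hn (ghostBound C h Q)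
    (aemeasurable_ghostBound hm hCm) (by positivity : (0 : ℝ) < 2 / n)
    (abs_ghostBound_le hC hh) (abs_ghostBound_update_sub_le hC hh) hs
  rw [integral_ghostBound hC hh hm hCm] at key
  refine (measureReal_mono ?_).trans (key.trans (le_of_eq ?_))
  · rintro x ⟨c, hc, hx⟩
    have := mean_sub_integral_le_ghostBound (Q := Q) hn hC hh hm hc (hCmeas c hc) x
    simp only [Set.mem_ofPred_eq]
    linarith
  · congr 2
    field_simp

end Symmetrization

/-! ### Two-sided deviations and the net argument. -/

section TwoSided

variable {X : Type*} {n : ℕ} {C : Set (X → ℝ)} [MeasurableSpace X] {Q : Measure X}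

/-- The deviation of the empirical mean of `h * c` from its expectation. -/
noncomputable def deviation (Q : Measure X) (h c : X → ℝ) (x : Fin n → X) : ℝ :=
  1 / (n : ℝ) * ∑ i, h (x i) * c (x i) - ∫ z, h z * c z ∂Q

/-- Lower deviations for `h` are upper deviations for `-h`, so `C` need not be symmetric. -/
theorem deviation_neg (h c : X → ℝ) (x : Fin n → X) :
    deviation Q (fun z => -h z) c x = -deviation Q h c x := by
  simp only [deviation, neg_mul, Finset.sum_neg_distrib, integral_neg]
  ring

variable [IsProbabilityMeasure Q]

theorem measureReal_abs_deviation_le (hn : 0 < n) (hC : ∀ c ∈ C, ∀ x, |c x| ≤ 1)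
    (hCmeas : ∀ c ∈ C, Measurable c) {h : X → ℝ} (hh : ∀ x, |h x| ≤ 1) (hm : Measurable h)
    (hCm : RademacherMeasurable n C Q) {s : ℝ} (hs : 0 ≤ s) :
    (Measure.pi fun _ : Fin n => Q).real
        {x | ∃ c ∈ C, 2 * rademacherComplexity n C Q + s < |deviation Q h c x|}
      ≤ 2 * Real.exp (-(n * s ^ 2 / 2)) := by
  have h1 := measureReal_uniform_deviation_le hn hC hCmeas hh hm hCm hs
  have h2 := measureReal_uniform_deviation_le (h := fun z => -h z) hn hC hCmeas
    (fun x => by rw [abs_neg]; exact hh x) hm.neg hCm hs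
  rw [two_mul (Real.exp _)]
  refine le_trans (measureReal_mono ?_ (measure_ne_top _ _))
    ((measureReal_union_le _ _).trans (add_le_add h1 h2))
  rintro x ⟨c, hc, hx⟩
  rcases lt_abs.1 hx with hx | hx
  · exact Or.inl ⟨c, hc, hx⟩
  · rw [← deviation_neg] at hx
    exact Or.inr ⟨c, hc, hx⟩

theorem measureReal_abs_deviation_finset_le {ι : Type*} (T : Finset ι) (hn : 0 < n)
    (hC : ∀ c ∈ C, ∀ x, |c x| ≤ 1) (hCmeas : ∀ c ∈ C, Measurable c) {h : ι → X → ℝ}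
    (hh : ∀ t ∈ T, ∀ x, |h t x| ≤ 1) (hm : ∀ t ∈ T, Measurable (h t))
    (hCm : RademacherMeasurable n C Q) {s : ℝ} (hs : 0 ≤ s) :
    (Measure.pi fun _ : Fin n => Q).real
        {x | ∃ t ∈ T, ∃ c ∈ C, 2 * rademacherComplexity n C Q + s < |deviation Q (h t) c x|}
      ≤ T.card * (2 * Real.exp (-(n * s ^ 2 / 2))) := by
  rw [← nsmul_eq_mul, ← Finset.sum_const]
  refine le_trans (measureReal_mono ?_ (measure_ne_top _ _)) ((measureReal_biUnion_finset_le T fun t =>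
    {x | ∃ c ∈ C, 2 * rademacherComplexity n C Q + s < |deviation Q (h t) c x|}).trans
    (Finset.sum_le_sum fun t ht =>
      measureReal_abs_deviation_le hn hC hCmeas (hh t ht) (hm t ht) hCm hs))
  rintro x ⟨t, ht, hx⟩
  exact Set.mem_biUnion ht hx

theorem integrable_mul_of_bounded {h c : X → ℝ} (hh : ∀ x, |h x| ≤ 1) (hm : Measurable h)
    (hc : ∀ x, |c x| ≤ 1) (hcm : Measurable c) : Integrable (fun z => h z * c z) Q :=
  Integrable.of_bound (hm.mul hcm).aestronglyMeasurable 1 (.of_forall fun z => by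
    rw [Real.norm_eq_abs, abs_mul]
    exact mul_le_one₀ (hh z) (abs_nonneg _) (hc z))

/-- The empirical mean and the expectation each move by at most `η`. -/
theorem abs_deviation_le_add {h h' c : X → ℝ} {η e : ℝ} (hh : ∀ x, |h x| ≤ 1)
    (hm : Measurable h) (hh' : ∀ x, |h' x| ≤ 1) (hm' : Measurable h') (hc : ∀ x, |c x| ≤ 1)
    (hcm : Measurable c) (hη : ∀ x, |h x - h' x| ≤ η) {x : Fin n → X}
    (hx : |deviation Q h' c x| ≤ e) : |deviation Q h c x| ≤ e + 2 * η := by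
  obtain ⟨z₀⟩ := Q.nonempty_of_neZero
  have hη0 : 0 ≤ η := (abs_nonneg _).trans (hη z₀)
  have hb : ∀ z, |h z * c z - h' z * c z| ≤ η := fun z => by
    rw [← sub_mul, abs_mul]
    exact (mul_le_of_le_one_right (abs_nonneg _) (hc z)).trans (hη z)
  have hsum : |1 / (n : ℝ) * ∑ i, h (x i) * c (x i) - 1 / (n : ℝ) * ∑ i, h' (x i) * c (x i)|
      ≤ η := by
    rw [← mul_sub, ← Finset.sum_sub_distrib, abs_mul,
      abs_of_nonneg (by positivity : (0 : ℝ) ≤ 1 / n)]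
    have h1 : |∑ i, (h (x i) * c (x i) - h' (x i) * c (x i))| ≤ n * η := by
      refine (Finset.abs_sum_le_sum_abs _ _).trans
        ((Finset.sum_le_sum fun i _ => hb (x i)).trans ?_)
      simp
    rcases Nat.eq_zero_or_pos n with rfl | hn
    · simpa using hη0
    · have hn' : (0 : ℝ) < n := by exact_mod_cast hn
      rw [div_mul_eq_mul_div, one_mul, div_le_iff₀ hn']
      linarith
  have hint : |∫ z, h z * c z ∂Q - ∫ z, h' z * c z ∂Q| ≤ η := by
    rw [← integral_sub (integrable_mul_of_bounded hh hm hc hcm)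
      (integrable_mul_of_bounded hh' hm' hc hcm)]
    simpa using norm_integral_le_of_norm_le_const (μ := Q) (f := fun z => h z * c z - h' z * c z)
      (.of_forall hb)
  unfold deviation at *
  rw [abs_le] at *
  constructor <;> linarith [hsum.1, hsum.2, hint.1, hint.2, hx.1, hx.2]

theorem card_mul_exp_le {n N : ℕ} (hn : 0 < n) {δ : ℝ} (hδ : δ ∈ Set.Ioo (0 : ℝ) 1) :
    (N : ℝ) * (2 * Real.exp (-(n * (2 * √((2 * Real.log N + Real.log (4 / δ)) / n)) ^ 2 / 2)))
      ≤ δ / 2 := by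
  have hδ0 := hδ.1
  -- `N = 0` covers an empty class `W`.
  rcases Nat.eq_zero_or_pos N with rfl | hN
  · simpa using half_pos hδ0 |>.le
  have hN' : (0 : ℝ) < N := by exact_mod_cast hN
  have hn' : (0 : ℝ) < n := by exact_mod_cast hn
  have hlN : 0 ≤ Real.log N := Real.log_natCast_nonneg N
  have hlδ : 0 ≤ Real.log (4 / δ) :=
    Real.log_nonneg (by rw [le_div_iff₀ hδ0]; linarith [hδ.2])
  have h1 : (n : ℝ) * (2 * √((2 * Real.log N + Real.log (4 / δ)) / n)) ^ 2 / 2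
      = 2 * (2 * Real.log N + Real.log (4 / δ)) := by
    rw [mul_pow, Real.sq_sqrt (by positivity)]
    field_simp
  -- Both logarithms are nonnegative, so the exponent is at most -(log N + log (4 / δ)).
  have h2 : Real.exp (-(2 * (2 * Real.log N + Real.log (4 / δ)))) ≤ (N * (4 / δ))⁻¹ := by
    rw [← Real.exp_log (by positivity : 0 < (N * (4 / δ))⁻¹), Real.exp_le_exp, Real.log_inv,
      Real.log_mul hN'.ne' (by positivity)]
    linarith
  rw [h1]
  calc (N : ℝ) * (2 * Real.exp (-(2 * (2 * Real.log N + Real.log (4 / δ)))))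
      ≤ N * (2 * (N * (4 / δ))⁻¹) := by gcongr
    _ = δ / 2 := by field_simp; norm_num

/-- Uniform deviation over the products of `C` with a class `W` of functions of `f`, weighted by
`g`, for an i.i.d. sample and a finite net `T` of `W`. -/
theorem measureReal_uniform_deviation_net_le (hn : 0 < n) (hC : ∀ c ∈ C, ∀ x, |c x| ≤ 1)
    (hCmeas : ∀ c ∈ C, Measurable c) (hCm : RademacherMeasurable n C Q)
    {f : X → unitInterval} (hf : Measurable f) {g : X → ℝ} (hg : ∀ x, |g x| ≤ 1)
    (hgm : Measurable g) {W : Set (unitInterval → ℝ)}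
    (hW : ∀ w ∈ W, Measurable w ∧ ∀ v, |w v| ≤ 1) {T : Finset (unitInterval → ℝ)} (hT : ↑T ⊆ W)
    {η : ℝ} (hcov : ∀ w ∈ W, ∃ w' ∈ T, ∀ v, |w v - w' v| ≤ η)
    {δ : ℝ} (hδ : δ ∈ Set.Ioo (0 : ℝ) 1) {Ω : Type*} [MeasurableSpace Ω] (μ : Measure Ω)
    [IsProbabilityMeasure μ] {Z : Fin n → Ω → X} (hZ : iIndepFun Z μ)
    (hZlaw : ∀ i, HasLaw (Z i) Q μ) :
    μ.real {ω | ¬ ∀ w ∈ W, ∀ c ∈ C, |deviation Q (fun z => w (f z) * g z) c fun i => Z i ω|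
      ≤ 2 * (rademacherComplexity n C Q + η
        + √((2 * Real.log T.card + Real.log (4 / δ)) / n))} ≤ δ / 2 := by
  set s := 2 * √((2 * Real.log T.card + Real.log (4 / δ)) / n) with hs
  have hs0 : 0 ≤ s := by positivity
  have hh : ∀ w ∈ W, ∀ x, |w (f x) * g x| ≤ 1 := fun w hw x => by
    rw [abs_mul]
    exact mul_le_one₀ ((hW w hw).2 _) (abs_nonneg _) (hg x)
  have hhm : ∀ w ∈ W, Measurable fun x => w (f x) * g x := fun w hw =>
    ((hW w hw).1.comp hf).mul hgm
  have hb := measureReal_abs_deviation_finset_le (Q := Q) T hn hC hCmeas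
    (h := fun w z => w (f z) * g z) (fun w hw => hh w (hT hw)) (fun w hw => hhm w (hT hw)) hCm hs0
  set B := {x : Fin n → X | ∃ w ∈ T, ∃ c ∈ C, 2 * rademacherComplexity n C Q + s
    < |deviation Q (fun z => w (f z) * g z) c x|} with hB
  have hZm : ∀ i, AEMeasurable (Z i) μ := fun i => (hZlaw i).aemeasurable
  have hmap : μ.map (fun ω i => Z i ω) = Measure.pi fun _ => Q := by
    rw [(iIndepFun_iff_map_fun_eq_pi_map hZm).1 hZ]
    simp_rw [fun i => (hZlaw i).map_eq]
  have hsub : {ω | ¬ ∀ w ∈ W, ∀ c ∈ C, |deviation Q (fun z => w (f z) * g z) c fun i => Z i ω|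
      ≤ 2 * (rademacherComplexity n C Q + η
        + √((2 * Real.log T.card + Real.log (4 / δ)) / n))}
      -- The bad set `B` need not be measurable; its measurable hull has the same mass and can be
      -- pulled back to `Ω`.
      ⊆ (fun ω i => Z i ω) ⁻¹' toMeasurable (Measure.pi fun _ : Fin n => Q) B := by
    intro ω hω
    refine subset_toMeasurable _ _ ?_
    by_contra hnB
    refine hω fun w hw c hc => ?_
    obtain ⟨w', hw', hww'⟩ := hcov w hw
    have h1 : |deviation Q (fun z => w' (f z) * g z) c fun i => Z i ω|
        ≤ 2 * rademacherComplexity n C Q + s := by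
      by_contra hlt
      exact hnB ⟨w', hw', c, hc, not_le.1 hlt⟩
    have h2 := abs_deviation_le_add (hh w hw) (hhm w hw) (hh w' (hT hw')) (hhm w' (hT hw'))
      (hC c hc) (hCmeas c hc) (η := η) (fun z => by
        rw [← sub_mul, abs_mul]
        exact (mul_le_of_le_one_right (abs_nonneg _) (hg z)).trans (hww' _)) h1
    refine h2.trans (le_of_eq ?_)
    rw [hs]
    ring
  refine (measureReal_mono hsub).trans ?_
  rw [measureReal_def, ← Measure.map_apply_of_aemeasurable (aemeasurable_pi_lambda _ hZm)
    (measurableSet_toMeasurable _ _), hmap, measure_toMeasurable]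
  exact hb.trans (card_mul_exp_le hn hδ)

end TwoSided

/-! ### Moments of witnesses under the positive and input laws. -/

section Moments

variable {X : Type*} [MeasurableSpace X] (P : Measure (X × Bool))

theorem measurableSet_positive : MeasurableSet {p : X × Bool | p.2 = true} :=
  measurable_snd (measurableSet_singleton true)

/-- The prior cancels the normalization of the conditional law, leaving the integral over the event
`Y = 1`, whose indicator is the label. -/
theorem prior_mul_integral_posLaw (hP : 0 < prior P) {g : X → ℝ} (hg : Measurable g) :
    prior P * ∫ z, g z ∂(posLaw P) = ∫ p, g p.1 * labelValue p.2 ∂P := by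
  rw [posLaw, integral_map measurable_fst.aemeasurable hg.aestronglyMeasurable,
    ProbabilityTheory.cond, integral_smul_measure, ENNReal.toReal_inv, smul_eq_mul,
    ← mul_assoc]
  have : prior P * ((P {p | p.2 = true}).toReal)⁻¹ = 1 := mul_inv_cancel₀ hP.ne'
  rw [this, one_mul, ← integral_indicator measurableSet_positive]
  congr 1
  funext p
  by_cases hp : p.2 = true <;> simp [labelValue, hp]

variable [IsProbabilityMeasure P]

theorem isProbabilityMeasure_posLaw (hP : 0 < prior P) : IsProbabilityMeasure (posLaw P) := by
  have h0 : P {p | p.2 = true} ≠ 0 := fun h => by simp [prior, measureReal_def, h] at hP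
  have := cond_isProbabilityMeasure h0
  exact Measure.isProbabilityMeasure_map measurable_fst.aemeasurable

instance isProbabilityMeasure_inputLaw : IsProbabilityMeasure (inputLaw P) :=
  Measure.isProbabilityMeasure_map measurable_fst.aemeasurable

/-- The moment of a witness in terms of the positive law and the input law. -/
theorem integral_witness_eq (hP : 0 < prior P) {f : X → unitInterval} (hf : Measurable f)
    {c : X → ℝ} (hc : ∀ x, |c x| ≤ 1) (hcm : Measurable c) {w : unitInterval → ℝ}
    (hw : ∀ v, |w v| ≤ 1) (hwm : Measurable w) :
    ∫ p, c p.1 * w (f p.1) * (labelValue p.2 - (f p.1 : ℝ)) ∂P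
      = prior P * ∫ z, w (f z) * 1 * c z ∂(posLaw P)
        - ∫ z, w (f z) * (f z : ℝ) * c z ∂(inputLaw P) := by
  have hfm : Measurable fun x => (f x : ℝ) := measurable_subtype_coe.comp hf
  have hwf : Measurable fun x => w (f x) := hwm.comp hf
  have hf1 : ∀ x, |(f x : ℝ)| ≤ 1 := fun x => by
    rw [abs_of_nonneg (f x).2.1]; exact (f x).2.2
  have hl : Measurable (labelValue : Bool → ℝ) := measurable_of_countable _
  have hl1 : ∀ y, |labelValue y| ≤ 1 := fun y => by cases y <;> simp [labelValue]
  have hwc : ∀ x, |w (f x) * c x| ≤ 1 := fun x => by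
    rw [abs_mul]; exact mul_le_one₀ (hw _) (abs_nonneg _) (hc x)
  have hwcm : Measurable fun x => w (f x) * c x := hwf.mul hcm
  have hwfcm : Measurable fun x => w (f x) * (f x : ℝ) * c x := (hwf.mul hfm).mul hcm
  have hi1 : Integrable (fun p : X × Bool => w (f p.1) * c p.1 * labelValue p.2) P :=
    integrable_mul_of_bounded (fun p => hwc p.1) (hwcm.comp measurable_fst)
      (fun p => hl1 p.2) (hl.comp measurable_snd)
  have hi2 : Integrable (fun p : X × Bool => w (f p.1) * c p.1 * (f p.1 : ℝ)) P :=
    integrable_mul_of_bounded (fun p => hwc p.1) (hwcm.comp measurable_fst)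
      (fun p => hf1 p.1) (hfm.comp measurable_fst)
  simp_rw [mul_one]
  rw [prior_mul_integral_posLaw P hP hwcm, inputLaw,
    integral_map measurable_fst.aemeasurable hwfcm.aestronglyMeasurable]
  have h2 : ∫ p : X × Bool, w (f p.1) * (f p.1 : ℝ) * c p.1 ∂P
      = ∫ p : X × Bool, w (f p.1) * c p.1 * (f p.1 : ℝ) ∂P :=
    integral_congr_ae (.of_forall fun p => by simp only; ring)
  rw [h2, ← integral_sub hi1 hi2]
  exact integral_congr_ae (.of_forall fun p => by simp only; ring)

theorem abs_integral_witness_le {f : X → unitInterval} {c : X → ℝ} (hc : ∀ x, |c x| ≤ 1)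
    {w : unitInterval → ℝ} (hw : ∀ v, |w v| ≤ 1) :
    |∫ p, c p.1 * w (f p.1) * (labelValue p.2 - (f p.1 : ℝ)) ∂P| ≤ 1 := by
  have hb : ∀ p : X × Bool, ‖c p.1 * w (f p.1) * (labelValue p.2 - (f p.1 : ℝ))‖ ≤ 1 := fun p => by
    have h1 : |c p.1 * w (f p.1)| ≤ 1 := by
      rw [abs_mul]; exact mul_le_one₀ (hc _) (abs_nonneg _) (hw _)
    have h2 : |labelValue p.2 - (f p.1 : ℝ)| ≤ 1 := by
      have h0 := (f p.1).2.1
      have h1 := (f p.1).2.2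
      rw [abs_le]
      cases p.2 <;> simp only [labelValue] <;> norm_num <;> constructor <;> linarith
    rw [Real.norm_eq_abs, abs_mul]
    exact mul_le_one₀ h1 (abs_nonneg _) h2
  simpa using norm_integral_le_of_norm_le_const (μ := P) (.of_forall hb)

/-- The PU estimate of a moment is off by a combination of the deviations in the two samples. -/
theorem puMoment_sub_integral_eq (hP : 0 < prior P) {f : X → unitInterval} (hf : Measurable f)
    {c : X → ℝ} (hc : ∀ x, |c x| ≤ 1) (hcm : Measurable c) {w : unitInterval → ℝ}
    (hw : ∀ v, |w v| ≤ 1) (hwm : Measurable w) {m n : ℕ} (xp : Fin m → X) (xu : Fin n → X) :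
    puMoment (prior P) c w f xp xu
        - ∫ p, c p.1 * w (f p.1) * (labelValue p.2 - (f p.1 : ℝ)) ∂P
      = prior P * deviation (posLaw P) (fun z => w (f z) * 1) c xp
        - deviation (inputLaw P) (fun z => w (f z) * (f z : ℝ)) c xu := by
  rw [integral_witness_eq P hP hf hc hcm hw hwm, puMoment, deviation, deviation]
  have h1 : ∑ i, c (xp i) * w (f (xp i)) = ∑ i, w (f (xp i)) * 1 * c (xp i) :=
    Finset.sum_congr rfl fun i _ => by ring
  have h2 : ∑ i, c (xu i) * w (f (xu i)) * (f (xu i) : ℝ)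
      = ∑ i, w (f (xu i)) * (f (xu i) : ℝ) * c (xu i) := Finset.sum_congr rfl fun i _ => by ring
  rw [h1, h2]
  ring

end Moments

/-- A finite covering number is attained. That the net lies inside `W` makes its members measurable
and bounded by 1. -/
theorem exists_finset_net {η : ℝ} (hη : 0 ≤ η) {W : Set (unitInterval → ℝ)}
    (hWη : supCoveringNumber η W ≠ ⊤) :
    ∃ T : Finset (unitInterval → ℝ), ↑T ⊆ W ∧ T.card = (supCoveringNumber η W).toNat ∧
      ∀ w ∈ W, ∃ w' ∈ T, ∀ v, |w v - w' v| ≤ η := by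
  obtain ⟨N, hNW, hfin, hcov, hcard⟩ := Metric.exists_set_encard_eq_coveringNumber hWη
  have hfin' : (UniformFun.toFun '' N).Finite := hfin.image _
  refine ⟨hfin'.toFinset, ?_, ?_, fun w hw => ?_⟩
  · intro w hw
    rw [Set.Finite.coe_toFinset] at hw
    obtain ⟨u, hu, rfl⟩ := hw
    obtain ⟨w, hw, rfl⟩ := hNW hu
    exact hw
  · rw [← Set.ncard_eq_toFinset_card _ hfin', Set.ncard_image_of_injective _
      (UniformFun.toFun (α := unitInterval) (β := ℝ)).injective, Set.ncard_def, hcard]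
    rfl
  · obtain ⟨u, hu, hd⟩ := hcov (Set.mem_image_of_mem UniformFun.ofFun hw)
    refine ⟨UniformFun.toFun u, by rw [Set.Finite.mem_toFinset]; exact ⟨u, hu, rfl⟩, fun v => ?_⟩
    have h := UniformFun.edist_le.1 hd v
    rw [edist_dist, ← Real.dist_eq] at *
    have h2 : ENNReal.ofReal (dist (w v) (UniformFun.toFun u v)) ≤ ENNReal.ofReal η := h
    exact (ENNReal.ofReal_le_ofReal_iff hη).1 h2

end PUMulticalibration

/-! ### The final bound from the two samples. -/

open PUMulticalibration in
theorem proposition2 {X Ω : Type*} [MeasurableSpace X] [MeasurableSpace Ω]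
    (P : Measure (X × Bool)) [IsProbabilityMeasure P] (hP : 0 < prior P)
    (f : X → unitInterval) (hf : Measurable f)
    (C : Set (X → ℝ)) (hC : ∀ c ∈ C, Measurable c ∧ ∀ x, c x ∈ Set.Icc (0 : ℝ) 1)
    (W : Set (unitInterval → ℝ)) (hW : ∀ w ∈ W, Measurable w ∧ ∀ v, |w v| ≤ 1)
    (np nu : ℕ) (hnp : 0 < np) (hnu : 0 < nu)
    (hCp : RademacherMeasurable np C (posLaw P))
    (hCu : RademacherMeasurable nu C (inputLaw P))
    (μ : Measure Ω) [IsProbabilityMeasure μ]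
    (Xp : Fin np → Ω → X) (hXp : iIndepFun Xp μ) (hXpLaw : ∀ i, HasLaw (Xp i) (posLaw P) μ)
    (Xu : Fin nu → Ω → X) (hXu : iIndepFun Xu μ) (hXuLaw : ∀ j, HasLaw (Xu j) (inputLaw P) μ)
    (η : ℝ) (hη : η ∈ Set.Ioc (0 : ℝ) 1) (hWη : supCoveringNumber η W ≠ ⊤)
    (δ : ℝ) (hδ : δ ∈ Set.Ioo (0 : ℝ) 1) :
    ∃ A : Set Ω, MeasurableSet A ∧ 1 - δ ≤ μ.real A ∧ ∀ ω ∈ A,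
      |puEstimate (prior P) C W f (fun i => Xp i ω) (fun j => Xu j ω)
          - multicalibrationError P C W f| ≤
        2 * (prior P * (rademacherComplexity np C (posLaw P) + η
              + √((2 * Real.log ((supCoveringNumber η W).toNat : ℝ) + Real.log (4 / δ)) / np))
            + 1 * (rademacherComplexity nu C (inputLaw P) + η
              + √((2 * Real.log ((supCoveringNumber η W).toNat : ℝ) + Real.log (4 / δ)) / nu))) := by
  have hC1 : ∀ c ∈ C, ∀ x, |c x| ≤ 1 := fun c hc x => by
    rw [abs_of_nonneg ((hC c hc).2 x).1]
    exact ((hC c hc).2 x).2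
  have hCm : ∀ c ∈ C, Measurable c := fun c hc => (hC c hc).1
  have := isProbabilityMeasure_posLaw P hP
  obtain ⟨T, hTW, hTcard, hcov⟩ := exists_finset_net hη.1.le hWη
  rw [← hTcard]
  have hp := measureReal_uniform_deviation_net_le hnp hC1 hCm hCp hf (g := fun _ => 1)
    (fun _ => by simp) measurable_const hW hTW hcov hδ μ hXp hXpLaw
  have hu := measureReal_uniform_deviation_net_le hnu hC1 hCm hCu hf (g := fun z => (f z : ℝ))
    (fun z => by rw [abs_of_nonneg (f z).2.1]; exact (f z).2.2)
    (measurable_subtype_coe.comp hf) hW hTW hcov hδ μ hXu hXuLaw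
  set ep := rademacherComplexity np C (posLaw P) + η
    + √((2 * Real.log T.card + Real.log (4 / δ)) / np) with hep
  set eu := rademacherComplexity nu C (inputLaw P) + η
    + √((2 * Real.log T.card + Real.log (4 / δ)) / nu) with heu
  have hep0 : 0 ≤ ep := add_nonneg
    (add_nonneg (rademacherComplexity_nonneg hC1 _) hη.1.le) (Real.sqrt_nonneg _)
  have heu0 : 0 ≤ eu := add_nonneg
    (add_nonneg (rademacherComplexity_nonneg hC1 _) hη.1.le) (Real.sqrt_nonneg _)
  set Ep := {ω | ¬ ∀ w ∈ W, ∀ c ∈ C,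
    |deviation (posLaw P) (fun z => w (f z) * 1) c fun i => Xp i ω| ≤ 2 * ep}
  set Eu := {ω | ¬ ∀ w ∈ W, ∀ c ∈ C,
    |deviation (inputLaw P) (fun z => w (f z) * (f z : ℝ)) c fun i => Xu i ω| ≤ 2 * eu}
  have hE : μ.real (toMeasurable μ (Ep ∪ Eu)) ≤ δ := by
    rw [measureReal_def, measure_toMeasurable]
    exact (measureReal_union_le Ep Eu).trans (by linarith)
  refine ⟨(toMeasurable μ (Ep ∪ Eu))ᶜ, (measurableSet_toMeasurable _ _).compl, ?_, ?_⟩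
  · rw [probReal_compl_eq_one_sub (measurableSet_toMeasurable _ _)]
    linarith
  intro ω hω
  have hω' : ω ∉ Ep ∪ Eu := fun h => hω (subset_toMeasurable _ _ h)
  have hωp : ∀ w ∈ W, ∀ c ∈ C,
      |deviation (posLaw P) (fun z => w (f z) * 1) c fun i => Xp i ω| ≤ 2 * ep :=
    not_not.1 fun h => hω' (Or.inl h)
  have hωu : ∀ w ∈ W, ∀ c ∈ C,
      |deviation (inputLaw P) (fun z => w (f z) * (f z : ℝ)) c fun i => Xu i ω| ≤ 2 * eu :=
    not_not.1 fun h => hω' (Or.inr h)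
  have hmom : ∀ cw : C × W,
      |puMoment (prior P) cw.1.1 cw.2.1 f (fun i => Xp i ω) (fun j => Xu j ω)
        - ∫ p, cw.1.1 p.1 * cw.2.1 (f p.1) * (labelValue p.2 - (f p.1 : ℝ)) ∂P|
      ≤ 2 * (prior P * ep + 1 * eu) := by
    rintro ⟨⟨c, hc⟩, w, hw⟩
    rw [puMoment_sub_integral_eq P hP hf (hC1 c hc) (hCm c hc) (hW w hw).2 (hW w hw).1]
    refine (abs_sub _ _).trans ?_
    rw [abs_mul, abs_of_pos hP]
    have h1 := mul_le_mul_of_nonneg_left (hωp w hw c hc) hP.le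
    linarith [hωu w hw c hc]
  have hI : ∀ cw : C × W,
      |∫ p, cw.1.1 p.1 * cw.2.1 (f p.1) * (labelValue p.2 - (f p.1 : ℝ)) ∂P| ≤ 1 := fun cw =>
    abs_integral_witness_le P (hC1 _ cw.1.2) (hW _ cw.2.2).2
  -- Both families must be bounded, since an unbounded real supremum defaults to 0: the true moments
  -- are at most 1, the estimates at most 1 plus the error.
  refine abs_iSup_sub_iSup_le (by positivity) ⟨2 * (prior P * ep + 1 * eu) + 1, ?_⟩ ⟨1, ?_⟩
    fun cw => (abs_abs_sub_abs_le _ _).trans (hmom cw)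
  · rintro _ ⟨cw, rfl⟩
    linarith [abs_sub_abs_le_abs_sub
      (puMoment (prior P) cw.1.1 cw.2.1 f (fun i => Xp i ω) (fun j => Xu j ω))
      (∫ p, cw.1.1 p.1 * cw.2.1 (f p.1) * (labelValue p.2 - (f p.1 : ℝ)) ∂P), hmom cw, hI cw]
  · rintro _ ⟨cw, rfl⟩
    exact hI cw
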